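/- Fix an integer $K\ge 1$ and reals $b>0$ and $0<\epsilon<1$. For each $n\ge 1$ consider a random computer cluster with set of servers $S^{(n)}=\{1,\dots,m^{(n)}\}$, $m^{(n)}=\lceil bn\rceil$, and set of job classes $I^{(n)}=\{1,\dots,Kn\}$, partitioned into $K$ parts $I^{(n)}_1,\dots,I^{(n)}_K$ of size $n$. Server $s$ has capacity $\mu^{(n)}_s\ge 0$, and for each $n$ at least one capacity is positive. The random sets of servers $\mathbf S^{(n)}_i$, $i\in I^{(n)}$, are independent, and for $i\in I^{(n)}_k$ the set $\mathbf S^{(n)}_i$ is uniformly distributed among the subsets of $S^{(n)}$ of cardinality $d^{(n)}_k$, where $1\le d^{(n)}_k\le m^{(n)}$ are integers. For $A\subset I^{(n)}$ let $$\mathbf M^{(n)}(A)=\sum_{s\in\bigcup_{i\in A}\mathbf S^{(n)}_i}\mu^{(n)}_s,\qquad \mu^{(n)}(A)=\mathbb E\big[\mathbf M^{(n)}(A)\big].$$ Assume that (1) the servers of $S^{(n)}$ are partitioned into a number of groups that does not depend on $n$, the servers of a group have the same capacity, and each group contains $\Omega(n)$ servers; (2) for each $k=1,\dots,K$, $d^{(n)}_k=\omega(\log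 n)$, that is, $d^{(n)}_k/\log n\to+\infty$ as $n\to\infty$. Then there is a real sequence $(g_n)_{n\ge 1}$ with $g_n=\omega(\log n)$ such that for every $n\ge 1$ $$\mathbb P\big\{\exists A\subset I^{(n)},\ A\neq\emptyset,\ \mathbf M^{(n)}(A)\le(1-\epsilon)\,\mu^{(n)}(A)\big\}\le e^{-g_n}$$ and $$\mathbb P\big\{\exists A\subset I^{(n)},\ A\neq\emptyset,\ \mathbf M^{(n)}(A)\ge(1+\epsilon)\,\mu^{(n)}(A)\big\}\le e^{-g_n}.$$ -/

import Mathlib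

open MeasureTheory ProbabilityTheory Filter

/-- Rank function of a cluster with `m` servers of capacities `cap`, in which the classes `i : I`
can be served by the sets of servers `S i`: the aggregate capacity available to the
classes in `A`. -/
def rankFun {I : Type*} {m : ℕ} (cap : Fin m → ℝ) (S : I → Finset (Fin m)) (A : Finset I) : ℝ :=
  ∑ s ∈ A.biUnion S, cap s

/-- Mean rank function of a cluster with random server assignment `S`. -/
noncomputable def meanRank {Ω I : Type*} [MeasurableSpace Ω] {m : ℕ} (P : Measure Ω)
    (cap : Fin m → ℝ) (S : I → Ω → Finset (Fin m)) (A : Finset I) : ℝ :=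
  ∫ ω, rankFun cap (fun i => S i ω) A ∂P

/-- The random sets `S i` of servers are independent, and each `S i` is uniformly distributed among
the sets of servers of cardinality `d i`. -/
structure IsUniformAssignment {Ω I : Type*} [MeasurableSpace Ω] {m : ℕ} (P : Measure Ω)
    (S : I → Ω → Finset (Fin m)) (d : I → ℕ) : Prop where
  hasLaw : ∀ i, HasLaw (S i) (uniformOn {T : Finset (Fin m) | T.card = d i}) P
  indep : iIndepFun S P

/-- `f n = ω(log n)` as `n → ∞`. -/
def IsOmegaLog (f : ℕ → ℝ) : Prop :=
  Tendsto (fun n : ℕ => f n / Real.log n) atTop atTop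

/-- `f n = Ω(n)` as `n → ∞`. -/
def IsBigOmegaLinear (f : ℕ → ℝ) : Prop :=
  ∃ c : ℝ, 0 < c ∧ ∀ᶠ n : ℕ in atTop, c * n ≤ f n

/-- The servers are partitioned into a number `J` of groups that does not depend on `n`; the servers
of a group have the same capacity, and each group contains `Ω(n)` servers. -/
def HasLinearServerGroups {m : ℕ → ℕ} (cap : ∀ n, Fin (m n) → ℝ) : Prop :=
  ∃ (J : ℕ) (grp : ∀ n, Fin (m n) → Fin J),
    (∀ n, 1 ≤ n → ∀ s t, grp n s = grp n t → cap n s = cap n t) ∧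
    ∀ j, IsBigOmegaLinear fun n => ((Finset.univ.filter fun s => grp n s = j).card : ℝ)

/-!
All servers of a group have the same capacity, so the rank of `A` is a nonnegative combination of the
numbers of servers of the groups `G` that are covered by `⋃_{i ∈ A} S i`, and a relative deviation
`ε` of the rank forces one of the same direction in some group. It therefore suffices to control, for
one group `G` of linear size and uniformly in `A`, the number `X(A) = |G ∩ ⋃_{i ∈ A} S i|`.

*Concentration for a fixed `A`.* The covered servers are negatively dependent, and the consequence
that is needed is that the probability generating function of `X(A)` is at most that of a binomial
variable with `|G|` trials and success probability `p_A = 1 - ∏_{i ∈ A} (1 - d i / m)`, at every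
`x > 0` (`BinomiallyDominated`). For one uniform set and `x ≥ 1` this holds because it contains a
given `C` with probability at most `(d / m) ^ |C|`; the case `x < 1` follows by complementation, and
the property passes to unions of independent sets (`BinomiallyDominated.union`). It determines the
mean `|G| p_A` and yields Chernoff bounds `exp (-δ² |G| p_A / 4)` in both directions.

*Uniformity in `A`.* Let `D` be the least degree `d i` and `L` a constant with `exp (-L) ≤ ε / 2`. If
`|A| D / m ≤ L + 1`, then `|G| p_A` is at least a constant times `|A| D`, so that the union bound
costs `∑_{A ≠ ∅} 2 q ^ |A| = 2 ((1 + q) ^ N - 1)`, where `N` is the number of classes and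
`q = exp (-const · D)`; this is `O(N q)`. A union bound over the larger `A` would fail, as there are
exponentially many of them, but they need none: `A` contains some `B` with
`L ≤ |B| D / m ≤ L + 1`, whose cover is already nearly all of `G` unless `B` itself deviates, while
`p_A` is so close to one that no upward deviation is possible (`exists_small_deviates`).
Since `N = K n` and `D = ω(log n)`, the bound `O(n exp (-const · D))` is `exp (-ω(log n))`.
-/

/-! ### Generating function of the intersection with a uniform random set -/

/-- A uniform `d`-subset of an `m`-set contains `c` given elements with probability at most
`(d / m) ^ c`, in a form free of divisions. -/
lemma choose_sub_sub_mul_pow_le {m d : ℕ} (hdm : d ≤ m) (c : ℕ) (hc : c ≤ d) :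
    (m - c).choose (d - c) * m ^ c ≤ m.choose d * d ^ c := by
  induction c with
  | zero => simp
  | succ c ih =>
    obtain ⟨e, rfl⟩ : ∃ e, d = c + 1 + e := ⟨d - (c + 1), by omega⟩
    obtain ⟨l, rfl⟩ : ∃ l, m = c + 1 + e + l := ⟨m - (c + 1 + e), by omega⟩
    have ih := ih (by omega)
    have e1 : c + 1 + e + l - (c + 1) = e + l := by omega
    have e2 : c + 1 + e - (c + 1) = e := by omega
    have e3 : c + 1 + e + l - c = e + l + 1 := by omega
    have e4 : c + 1 + e - c = e + 1 := by omega
    rw [e1, e2]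
    rw [e3, e4] at ih
    have key := Nat.add_one_mul_choose_eq (e + l) e
    have step : (e + l).choose e * (c + 1 + e + l) ≤ (e + l + 1).choose (e + 1) * (c + 1 + e) := by
      refine Nat.le_of_mul_le_mul_left (c := e + l + 1) ?_ (by omega)
      calc (e + l + 1) * ((e + l).choose e * (c + 1 + e + l))
          = (e + l + 1).choose (e + 1) * ((e + 1) * (c + 1 + e + l)) := by
            rw [← mul_assoc, key, mul_assoc]
        _ ≤ (e + l + 1).choose (e + 1) * ((e + l + 1) * (c + 1 + e)) := by
            refine Nat.mul_le_mul_left _ ?_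
            nlinarith [Nat.zero_le (c * l)]
        _ = _ := by ring
    calc (e + l).choose e * (c + 1 + e + l) ^ (c + 1)
        = (e + l).choose e * (c + 1 + e + l) * (c + 1 + e + l) ^ c := by ring
      _ ≤ (e + l + 1).choose (e + 1) * (c + 1 + e) * (c + 1 + e + l) ^ c :=
          Nat.mul_le_mul_right _ step
      _ = (e + l + 1).choose (e + 1) * (c + 1 + e + l) ^ c * (c + 1 + e) := by ring
      _ ≤ (c + 1 + e + l).choose (c + 1 + e) * (c + 1 + e) ^ c * (c + 1 + e) :=
          Nat.mul_le_mul_right _ ih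
      _ = _ := by ring

lemma card_filter_subset_powersetCard_le {m d : ℕ} (hdm : d ≤ m) (hm : 0 < m)
    (C : Finset (Fin m)) :
    (((Finset.univ.powersetCard d).filter (C ⊆ ·)).card : ℝ)
      ≤ m.choose d * ((d : ℝ) / m) ^ C.card := by
  by_cases hc : C.card ≤ d
  · rw [Finset.card_filter_powersetCard_subset C Finset.univ d (Finset.subset_univ _) hc,
      Finset.card_univ, Fintype.card_fin, div_pow, ← mul_div_assoc, le_div_iff₀ (by positivity)]
    exact_mod_cast choose_sub_sub_mul_pow_le hdm _ hc
  · rw [Finset.card_eq_zero.mpr]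
    · simp only [Nat.cast_zero]; positivity
    · refine Finset.filter_eq_empty_iff.mpr fun T hT hCT => hc ?_
      rw [← (Finset.mem_powersetCard.mp hT).2]
      exact Finset.card_le_card hCT

/-- The case `1 ≤ x` of `sum_powersetCard_pow_le`, where `(1 + y) ^ |G ∩ T|` expands into a sum with
nonnegative coefficients over the subsets of `G` contained in `T`. -/
lemma sum_powersetCard_one_add_pow_le {m d : ℕ} (hdm : d ≤ m) (hm : 0 < m) (G : Finset (Fin m))
    {y : ℝ} (hy : 0 ≤ y) :
    ∑ T ∈ Finset.univ.powersetCard d, (1 + y) ^ (G ∩ T).card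
      ≤ m.choose d * (1 + y * ((d : ℝ) / m)) ^ G.card := by
  have expand : ∀ T : Finset (Fin m), (1 + y) ^ (G ∩ T).card
      = ∑ C ∈ G.powerset, if C ⊆ T then y ^ C.card else 0 := by
    intro T
    rw [← Finset.sum_filter, ← Finset.prod_const, Finset.prod_one_add]
    simp only [Finset.prod_const]
    refine Finset.sum_congr ?_ fun _ _ => rfl
    ext C
    rw [Finset.mem_powerset, Finset.subset_inter_iff, Finset.mem_filter, Finset.mem_powerset]
  calc ∑ T ∈ Finset.univ.powersetCard d, (1 + y) ^ (G ∩ T).card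
      = ∑ C ∈ G.powerset, y ^ C.card * ((Finset.univ.powersetCard d).filter (C ⊆ ·)).card := by
        simp_rw [expand]
        rw [Finset.sum_comm]
        refine Finset.sum_congr rfl fun C _ => ?_
        rw [← Finset.sum_filter, Finset.sum_const, nsmul_eq_mul, mul_comm]
    _ ≤ ∑ C ∈ G.powerset, y ^ C.card * (m.choose d * ((d : ℝ) / m) ^ C.card) := by
        gcongr with C
        exact card_filter_subset_powersetCard_le hdm hm C
    _ = m.choose d * (1 + y * ((d : ℝ) / m)) ^ G.card := by
        rw [← Finset.prod_const, Finset.prod_one_add, Finset.mul_sum]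
        refine Finset.sum_congr rfl fun C _ => ?_
        rw [Finset.prod_const, mul_pow]
        ring

/-- The generating function of the hypergeometric law is at most that of the binomial law with the
same number of trials and the same mean. For `x < 1`, the bound is that for `x⁻¹ > 1` and the
complementary sets. -/
lemma sum_powersetCard_pow_le {m d : ℕ} (hdm : d ≤ m) (hm : 0 < m) (G : Finset (Fin m))
    {x : ℝ} (hx : 0 < x) :
    ∑ T ∈ Finset.univ.powersetCard d, x ^ (G ∩ T).card
      ≤ m.choose d * (1 + (x - 1) * ((d : ℝ) / m)) ^ G.card := by
  rcases le_total 1 x with h1 | h1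
  · simpa using sum_powersetCard_one_add_pow_le hdm hm G (sub_nonneg.mpr h1)
  · have hy : 0 ≤ x⁻¹ - 1 := sub_nonneg.mpr ((one_le_inv₀ hx).mpr h1)
    have key := sum_powersetCard_one_add_pow_le (Nat.sub_le m d) hm G hy
    rw [Nat.choose_symm hdm, add_sub_cancel, Nat.cast_sub hdm] at key
    have compl : ∑ T ∈ Finset.univ.powersetCard d, x ^ (G ∩ T).card
        = x ^ G.card * ∑ T ∈ Finset.univ.powersetCard (m - d), x⁻¹ ^ (G ∩ T).card := by
      rw [Finset.mul_sum]
      refine Finset.sum_nbij' (fun T => Tᶜ) (fun T => Tᶜ) ?_ ?_ (by simp) (by simp) ?_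
      · intro T hT
        have := (Finset.mem_powersetCard.mp hT).2
        simp [Finset.mem_powersetCard, Finset.card_compl, this]
      · intro T hT
        have := (Finset.mem_powersetCard.mp hT).2
        simp [Finset.mem_powersetCard, Finset.card_compl, this, Nat.sub_sub_self hdm]
      · intro T _
        have h := Finset.card_inter_add_card_sdiff G T
        rw [Finset.sdiff_eq_inter_compl] at h
        rw [← h, pow_add, mul_assoc, ← mul_pow, mul_inv_cancel₀ hx.ne', one_pow, mul_one]
    rw [compl]
    calc x ^ G.card * ∑ T ∈ Finset.univ.powersetCard (m - d), x⁻¹ ^ (G ∩ T).card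
        ≤ x ^ G.card * (m.choose d * (1 + (x⁻¹ - 1) * (((m : ℝ) - d) / m)) ^ G.card) := by
          gcongr
      _ = m.choose d * (x * (1 + (x⁻¹ - 1) * (((m : ℝ) - d) / m))) ^ G.card := by
          rw [mul_pow]; ring
      _ = _ := by
          congr 2
          field_simp
          ring

/-- If `m < d`, both sides are zero. -/
lemma integral_uniformOn_card_eq {m d : ℕ} (f : Finset (Fin m) → ℝ) :
    ∫ T, f T ∂(uniformOn {T : Finset (Fin m) | T.card = d})
      = (∑ T ∈ Finset.univ.powersetCard d, f T) / m.choose d := by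
  have hset : {T : Finset (Fin m) | T.card = d}
      = ((Finset.univ.powersetCard d : Finset (Finset (Fin m))) : Set (Finset (Fin m))) := by
    ext T; simp [Finset.mem_powersetCard]
  have : IsFiniteMeasure (uniformOn {T : Finset (Fin m) | T.card = d}) := by
    unfold uniformOn; infer_instance
  rw [integral_fintype Integrable.of_finite, Finset.sum_div,
    ← Finset.sum_subset (Finset.subset_univ (Finset.univ.powersetCard d))]
  · refine Finset.sum_congr rfl fun T hT => ?_
    rw [hset, measureReal_def, ← Finset.coe_singleton, uniformOn_apply_finset,
      Finset.inter_singleton_of_mem hT]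
    simp [div_eq_inv_mul]
  · intro T _ hT
    rw [hset, measureReal_def, ← Finset.coe_singleton, uniformOn_apply_finset,
      Finset.inter_singleton_of_notMem hT]
    simp

/-! ### Random sets dominated by the binomial law -/

/-- For every `G`, the probability generating function of `|G ∩ X|` is at most that of the binomial
law with `|G|` trials and success probability `p`, at all positive arguments. Arguments below one
control the lower tail and arguments above one the upper tail. -/
def BinomiallyDominated {Ω : Type*} [MeasurableSpace Ω] {m : ℕ} (P : Measure Ω)
    (X : Ω → Finset (Fin m)) (p : ℝ) : Prop :=
  ∀ (G : Finset (Fin m)) (x : ℝ), 0 < x →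
    ∫ ω, x ^ (G ∩ X ω).card ∂P ≤ (1 + (x - 1) * p) ^ G.card

section
variable {Ω : Type*} [MeasurableSpace Ω] {m : ℕ} {P : Measure Ω}

lemma integrable_comp_finset [IsFiniteMeasure P] {X : Ω → Finset (Fin m)} (hX : AEMeasurable X P)
    (f : Finset (Fin m) → ℝ) : Integrable (fun ω => f (X ω)) P :=
  (Integrable.of_finite (μ := P.map X) (f := f)).comp_aemeasurable hX

lemma BinomiallyDominated.empty [IsProbabilityMeasure P] :
    BinomiallyDominated P (fun _ => (∅ : Finset (Fin m))) 0 := fun G x _ => by simp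

lemma BinomiallyDominated.of_hasLaw {d : ℕ} (hdm : d ≤ m) (hm : 0 < m) {X : Ω → Finset (Fin m)}
    (hX : HasLaw X (uniformOn {T : Finset (Fin m) | T.card = d}) P) :
    BinomiallyDominated P X ((d : ℝ) / m) := by
  intro G x hx
  have h := hX.integral_comp (f := fun T => x ^ (G ∩ T).card)
    StronglyMeasurable.of_discrete.aestronglyMeasurable
  simp only [Function.comp_def] at h
  rw [h, integral_uniformOn_card_eq,
    div_le_iff₀' (by exact_mod_cast Nat.choose_pos hdm)]
  exact sum_powersetCard_pow_le hdm hm G hx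

/-- Given `X`, the bound for `Y` applies to `G \ X` and gives a multiple of `(x / c) ^ |G ∩ X|`
with `c = 1 + (x - 1) q`, to which the bound for `X` applies. -/
lemma BinomiallyDominated.union [IsProbabilityMeasure P] {X Y : Ω → Finset (Fin m)} {p q : ℝ}
    (hX : AEMeasurable X P) (hY : AEMeasurable Y P) (hXY : IndepFun X Y P)
    (hXp : BinomiallyDominated P X p) (hYq : BinomiallyDominated P Y q)
    (hq0 : 0 ≤ q) (hq1 : q ≤ 1) :
    BinomiallyDominated P (fun ω => X ω ∪ Y ω) (1 - (1 - p) * (1 - q)) := by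
  intro G x hx
  have hc : 0 < 1 + (x - 1) * q := by
    rcases hq0.eq_or_lt with rfl | h
    · simp
    · nlinarith [mul_pos hx h]
  set c := 1 + (x - 1) * q with hcdef
  have := Measure.isProbabilityMeasure_map hX (μ := P)
  have := Measure.isProbabilityMeasure_map hY (μ := P)
  have split : ∀ S T : Finset (Fin m),
      x ^ (G ∩ (S ∪ T)).card = x ^ (G ∩ S).card * x ^ ((G \ S) ∩ T).card := by
    intro S T
    rw [← pow_add, ← Finset.card_union_of_disjoint]
    · congr 2
      ext a
      simp only [Finset.mem_inter, Finset.mem_union, Finset.mem_sdiff]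
      tauto
    · refine Finset.disjoint_left.mpr fun a ha hb => ?_
      simp only [Finset.mem_inter, Finset.mem_sdiff] at ha hb
      exact hb.1.2 ha.2
  calc ∫ ω, x ^ (G ∩ (X ω ∪ Y ω)).card ∂P
      = ∫ z, x ^ (G ∩ (z.1 ∪ z.2)).card ∂(P.map fun ω => (X ω, Y ω)) :=
        (integral_map (hX.prodMk hY)
          (f := fun z : Finset (Fin m) × Finset (Fin m) => x ^ (G ∩ (z.1 ∪ z.2)).card)
          StronglyMeasurable.of_discrete.aestronglyMeasurable).symm
    _ = ∫ S, ∫ T, x ^ (G ∩ (S ∪ T)).card ∂(P.map Y) ∂(P.map X) := by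
        rw [(indepFun_iff_map_prod_eq_prod_map_map hX hY).mp hXY,
          integral_prod _ Integrable.of_finite]
    _ ≤ ∫ S, c ^ G.card * (x / c) ^ (G ∩ S).card ∂(P.map X) := by
        refine integral_mono Integrable.of_finite Integrable.of_finite fun S => ?_
        simp only [split, integral_const_mul]
        rw [integral_map hY StronglyMeasurable.of_discrete.aestronglyMeasurable]
        calc x ^ (G ∩ S).card * ∫ ω, x ^ ((G \ S) ∩ Y ω).card ∂P
            ≤ x ^ (G ∩ S).card * c ^ (G \ S).card := by
              gcongr
              exact hYq _ x hx
          _ = c ^ G.card * (x / c) ^ (G ∩ S).card := by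
              rw [← Finset.card_inter_add_card_sdiff G S, pow_add, div_pow]
              field_simp
    _ = c ^ G.card * ∫ ω, (x / c) ^ (G ∩ X ω).card ∂P := by
        rw [integral_const_mul, integral_map hX StronglyMeasurable.of_discrete.aestronglyMeasurable]
    _ ≤ c ^ G.card * (1 + (x / c - 1) * p) ^ G.card := by
        gcongr
        exact hXp G _ (by positivity)
    _ = _ := by
        rw [← mul_pow]
        congr 1
        field_simp
        rw [hcdef]
        ring

/-- Domination at two arguments on either side of one determines the mean: for a single server the
generating function is affine in `x`, with value one at `x = 1`. -/
lemma BinomiallyDominated.integral_card [IsProbabilityMeasure P] {X : Ω → Finset (Fin m)} {p : ℝ}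
    (hX : AEMeasurable X P) (h : BinomiallyDominated P X p) (G : Finset (Fin m)) :
    ∫ ω, ((G ∩ X ω).card : ℝ) ∂P = G.card * p := by
  have single : ∀ s : Fin m, ∫ ω, (if s ∈ X ω then (1 : ℝ) else 0) ∂P = p := by
    intro s
    have hint := integrable_comp_finset (P := P) hX fun T => if s ∈ T then (1 : ℝ) else 0
    have affine : ∀ x : ℝ, ∫ ω, x ^ (({s} : Finset (Fin m)) ∩ X ω).card ∂P
        = 1 + (x - 1) * ∫ ω, (if s ∈ X ω then (1 : ℝ) else 0) ∂P := by
      intro x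
      have pt : ∀ ω, x ^ (({s} : Finset (Fin m)) ∩ X ω).card
          = 1 + (x - 1) * (if s ∈ X ω then (1 : ℝ) else 0) := by
        intro ω
        by_cases hs : s ∈ X ω
        · simp [hs]
        · simp [hs]
      simp only [pt]
      rw [integral_add (integrable_const _) (hint.const_mul _), integral_const_mul]
      simp
    have h2 := h {s} 2 (by norm_num)
    have h1 := h {s} (1 / 2) (by norm_num)
    rw [affine, Finset.card_singleton, pow_one] at h1 h2
    linarith
  have pt : ∀ ω, ((G ∩ X ω).card : ℝ) = ∑ s ∈ G, if s ∈ X ω then (1 : ℝ) else 0 := by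
    intro ω
    rw [Finset.sum_boole, Finset.filter_mem_eq_inter]
  simp only [pt]
  rw [integral_finsetSum _ fun s _ =>
    integrable_comp_finset (P := P) hX fun T => if s ∈ T then (1 : ℝ) else 0]
  simp [single]

lemma BinomiallyDominated.mgf_le [IsProbabilityMeasure P] {X : Ω → Finset (Fin m)} {p : ℝ}
    (hp : 0 ≤ p) (hp1 : p ≤ 1) (h : BinomiallyDominated P X p)
    (G : Finset (Fin m)) {t : ℝ} (ht : |t| ≤ 1) :
    mgf (fun ω => ((G ∩ X ω).card : ℝ)) P t ≤ Real.exp (G.card * p * (t + t ^ 2)) := by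
  have h0 : 0 ≤ 1 + (Real.exp t - 1) * p := by nlinarith [mul_nonneg (Real.exp_pos t).le hp]
  calc mgf (fun ω => ((G ∩ X ω).card : ℝ)) P t
      = ∫ ω, Real.exp t ^ (G ∩ X ω).card ∂P := by
        unfold mgf
        congr 1 with ω
        rw [← Real.exp_nat_mul, mul_comm]
    _ ≤ (1 + (Real.exp t - 1) * p) ^ G.card := h G _ (Real.exp_pos t)
    _ ≤ Real.exp ((t + t ^ 2) * p) ^ G.card := by
        gcongr
        have e1 := (abs_le.mp (Real.abs_exp_sub_one_sub_id_le ht)).2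
        calc 1 + (Real.exp t - 1) * p ≤ (t + t ^ 2) * p + 1 := by nlinarith
          _ ≤ _ := Real.add_one_le_exp _
    _ = _ := by
        rw [← Real.exp_nat_mul]
        ring_nf

lemma BinomiallyDominated.measure_le [IsProbabilityMeasure P] {X : Ω → Finset (Fin m)} {p : ℝ}
    (hX : AEMeasurable X P) (hp : 0 ≤ p) (hp1 : p ≤ 1) (h : BinomiallyDominated P X p)
    (G : Finset (Fin m)) {δ : ℝ} (hδ0 : 0 ≤ δ) (hδ1 : δ ≤ 1) :
    P.real {ω | ((G ∩ X ω).card : ℝ) ≤ (1 - δ) * (G.card * p)}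
      ≤ Real.exp (-(δ ^ 2 / 4) * (G.card * p)) := by
  have hint := integrable_comp_finset (P := P) hX
    fun T => Real.exp (-(δ / 2) * ((G ∩ T).card : ℝ))
  refine (measure_le_le_exp_mul_mgf _ (by linarith : -(δ / 2) ≤ 0) hint).trans ?_
  refine (mul_le_mul_of_nonneg_left (h.mgf_le hp hp1 G (t := -(δ / 2)) ?_)
    (Real.exp_pos _).le).trans_eq ?_
  · rw [abs_neg, abs_of_nonneg] <;> linarith
  · rw [← Real.exp_add]
    ring_nf

lemma BinomiallyDominated.measure_ge [IsProbabilityMeasure P] {X : Ω → Finset (Fin m)} {p : ℝ}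
    (hX : AEMeasurable X P) (hp : 0 ≤ p) (hp1 : p ≤ 1) (h : BinomiallyDominated P X p)
    (G : Finset (Fin m)) {δ : ℝ} (hδ0 : 0 ≤ δ) (hδ1 : δ ≤ 1) :
    P.real {ω | (1 + δ) * (G.card * p) ≤ ((G ∩ X ω).card : ℝ)}
      ≤ Real.exp (-(δ ^ 2 / 4) * (G.card * p)) := by
  have hint := integrable_comp_finset (P := P) hX
    fun T => Real.exp (δ / 2 * ((G ∩ T).card : ℝ))
  refine (measure_ge_le_exp_mul_mgf _ (by linarith : 0 ≤ δ / 2) hint).trans ?_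
  refine (mul_le_mul_of_nonneg_left (h.mgf_le hp hp1 G (t := δ / 2) ?_)
    (Real.exp_pos _).le).trans_eq ?_
  · rw [abs_of_nonneg] <;> linarith
  · rw [← Real.exp_add]
    ring_nf

end

/-! ### Covering probability and the union of the server sets -/

/-- Probability that a given server, among `m`, belongs to one of the independent uniform sets of
cardinalities `d i`, `i ∈ A`. -/
noncomputable def coverProb {I : Type*} (m : ℕ) (d : I → ℕ) (A : Finset I) : ℝ :=
  1 - ∏ i ∈ A, (1 - (d i : ℝ) / m)

section
variable {I : Type*} {m : ℕ} {d : I → ℕ}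

lemma one_sub_div_nonneg (hd : ∀ i, d i ≤ m) (i : I) : 0 ≤ 1 - (d i : ℝ) / m :=
  sub_nonneg.mpr (div_le_one_of_le₀ (by exact_mod_cast hd i) (Nat.cast_nonneg _))

lemma one_sub_div_le_one (i : I) : 1 - (d i : ℝ) / m ≤ 1 :=
  sub_le_self _ (by positivity)

lemma coverProb_le_one (hd : ∀ i, d i ≤ m) (A : Finset I) : coverProb m d A ≤ 1 :=
  sub_le_self _ (Finset.prod_nonneg fun i _ => one_sub_div_nonneg hd i)

lemma coverProb_nonneg (hd : ∀ i, d i ≤ m) (A : Finset I) : 0 ≤ coverProb m d A :=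
  sub_nonneg.mpr (Finset.prod_le_one (fun i _ => one_sub_div_nonneg hd i)
    fun i _ => one_sub_div_le_one i)

lemma one_sub_exp_le_coverProb (hd : ∀ i, d i ≤ m) {D : ℝ} (hD : ∀ i, D ≤ d i) (A : Finset I) :
    1 - Real.exp (-(A.card * (D / m))) ≤ coverProb m d A := by
  refine sub_le_sub_left ?_ 1
  calc ∏ i ∈ A, (1 - (d i : ℝ) / m) ≤ ∏ _i ∈ A, Real.exp (-(D / m)) := by
        refine Finset.prod_le_prod (fun i _ => one_sub_div_nonneg hd i) fun i _ => ?_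
        calc 1 - (d i : ℝ) / m ≤ 1 - D / m := by gcongr; exact hD i
          _ ≤ Real.exp (-(D / m)) := by linarith [Real.add_one_le_exp (-(D / m))]
    _ = _ := by
        rw [Finset.prod_const, ← Real.exp_nat_mul]
        ring_nf

end

section
variable {Ω I : Type*} [MeasurableSpace Ω] {m : ℕ} {P : Measure Ω}
  {S : I → Ω → Finset (Fin m)} {d : I → ℕ}

lemma IsUniformAssignment.aemeasurable_biUnion (hS : IsUniformAssignment P S d) (A : Finset I) :
    AEMeasurable (fun ω => A.biUnion fun i => S i ω) P := by
  have hf : Measurable fun u : (A → Finset (Fin m)) =>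
      (Finset.univ : Finset A).biUnion u := Measurable.of_discrete
  have h := hf.comp_aemeasurable (aemeasurable_pi_lambda (fun ω (i : A) => S i ω)
    fun i => (hS.hasLaw i).aemeasurable)
  convert h using 2 with ω
  ext s
  simp

lemma IsUniformAssignment.binomiallyDominated [IsProbabilityMeasure P]
    (hS : IsUniformAssignment P S d) (hm : 0 < m) (hd : ∀ i, d i ≤ m) (A : Finset I) :
    BinomiallyDominated P (fun ω => A.biUnion fun i => S i ω) (coverProb m d A) := by
  classical
  induction A using Finset.induction_on with
  | empty => simpa [coverProb] using BinomiallyDominated.empty (P := P) (m := m)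
  | insert a A ha ih =>
    have hmeas : ∀ i, AEMeasurable (S i) P := fun i => (hS.hasLaw i).aemeasurable
    have hind := hS.indep.indepFun_finset₀ {a} A (Finset.disjoint_singleton_left.mpr ha) hmeas
    have hind' := hind.comp
      (φ := fun u : (({a} : Finset I) → Finset (Fin m)) => u ⟨a, Finset.mem_singleton_self a⟩)
      (ψ := fun u : (A → Finset (Fin m)) => (Finset.univ : Finset A).biUnion u)
      Measurable.of_discrete Measurable.of_discrete
    have hind'' : IndepFun (S a) (fun ω => A.biUnion fun i => S i ω) P := by
      convert hind' using 1
      all_goals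
        ext ω s
        simp
    have h := (BinomiallyDominated.of_hasLaw (hd a) hm (hS.hasLaw a)).union (hmeas a)
      (hS.aemeasurable_biUnion A) hind'' ih (coverProb_nonneg hd A) (coverProb_le_one hd A)
    convert h using 1
    · ext ω : 1
      exact Finset.biUnion_insert
    · rw [coverProb, coverProb, Finset.prod_insert ha]
      ring

end

/-! ### Deviations, uniformly over the sets of classes -/

lemma one_add_pow_sub_one_le {q : ℝ} (hq : 0 ≤ q) (N : ℕ) (h : N * q ≤ 1) :
    (1 + q) ^ N - 1 ≤ 2 * (N * q) := by
  have h0 : 0 ≤ N * q := by positivity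
  have h1 : (1 + q) ^ N ≤ Real.exp (N * q) := by
    rw [Real.exp_nat_mul]
    gcongr
    linarith [Real.add_one_le_exp q]
  have h2 := (abs_le.mp (Real.abs_exp_sub_one_le (x := N * q) (by rwa [abs_of_nonneg h0]))).2
  rw [abs_of_nonneg h0] at h2
  linarith

lemma sum_nonempty_pow_card (I : Type*) [Fintype I] (q : ℝ) :
    ∑ A : Finset I with A.Nonempty, q ^ A.card = (1 + q) ^ Fintype.card I - 1 := by
  classical
  have h : ∑ A : Finset I, q ^ A.card = (1 + q) ^ Fintype.card I := by
    rw [← Finset.card_univ, ← Finset.prod_const, Finset.prod_one_add, Finset.powerset_univ]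
    simp
  have h' : ({A : Finset I | A.Nonempty} : Finset (Finset I)) = Finset.univ.erase ∅ := by
    ext A; simp [Finset.nonempty_iff_ne_empty]
  rw [h', ← h, ← Finset.add_sum_erase _ _ (Finset.mem_univ ∅)]
  simp

lemma div_le_one_sub_exp_neg {y L : ℝ} (hy : 0 ≤ y) (hyL : y ≤ L) :
    y / (L + 1) ≤ 1 - Real.exp (-y) := by
  have h1 : Real.exp (-y) ≤ 1 / (1 + y) := by
    rw [Real.exp_neg, ← one_div]
    exact one_div_le_one_div_of_le (by linarith) (by linarith [Real.add_one_le_exp y])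
  have h2 : y / (L + 1) ≤ y / (1 + y) :=
    div_le_div_of_nonneg_left hy (by linarith) (by linarith)
  have h3 : y / (1 + y) = 1 - 1 / (1 + y) := by field_simp; ring
  linarith

section
variable {Ω I : Type*} [MeasurableSpace Ω] {m : ℕ} {P : Measure Ω}
  {S : I → Ω → Finset (Fin m)} {d : I → ℕ}

/-- `|G ∩ T|` is at most `1 - δ` times or at least `1 + δ` times `|G| p`, which is its mean when each
server belongs to `T` with probability `p`. -/
def Deviates (T : Finset (Fin m)) (G : Finset (Fin m)) (δ p : ℝ) : Prop :=
  ((G ∩ T).card : ℝ) ≤ (1 - δ) * (G.card * p) ∨ (1 + δ) * (G.card * p) ≤ (G ∩ T).card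

lemma BinomiallyDominated.measure_deviates [IsProbabilityMeasure P] {X : Ω → Finset (Fin m)} {p : ℝ}
    (hX : AEMeasurable X P) (hp : 0 ≤ p) (hp1 : p ≤ 1) (h : BinomiallyDominated P X p)
    (G : Finset (Fin m)) {δ : ℝ} (hδ0 : 0 ≤ δ) (hδ1 : δ ≤ 1) :
    P.real {ω | Deviates (X ω) G δ p} ≤ 2 * Real.exp (-(δ ^ 2 / 4) * (G.card * p)) := by
  have h1 := h.measure_le hX hp hp1 G hδ0 hδ1
  have h2 := h.measure_ge hX hp hp1 G hδ0 hδ1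
  have h3 := measureReal_union_le (μ := P) {ω | ((G ∩ X ω).card : ℝ) ≤ (1 - δ) * (G.card * p)}
    {ω | (1 + δ) * (G.card * p) ≤ ((G ∩ X ω).card : ℝ)}
  rw [← Set.ofPred_or] at h3
  refine h3.trans ?_
  linarith

/-- A relative deviation `ε` of any nonempty set of classes entails a relative
deviation `ε / 2` of a set of at most `(L + 1) m / D` classes. The statement is deterministic. -/
lemma exists_small_deviates (hd : ∀ i, d i ≤ m) {D L ε : ℝ} (hD : ∀ i, D ≤ d i) (hD0 : 0 < D)
    (hm : 0 < m) (hL : 0 < L) (hε0 : 0 < ε) (hε1 : ε < 1) (hLε : Real.exp (-L) ≤ ε / 2)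
    {G : Finset (Fin m)} (hG : G.Nonempty) (T : I → Finset (Fin m)) {A : Finset I}
    (hA : A.Nonempty) (hdev : Deviates (A.biUnion T) G ε (coverProb m d A)) :
    ∃ B : Finset I, B.Nonempty ∧ B.card * (D / m) ≤ L + 1 ∧
      Deviates (B.biUnion T) G (ε / 2) (coverProb m d B) := by
  have hγ : (0 : ℝ) < G.card := by exact_mod_cast hG.card_pos
  have hm' : (0 : ℝ) < m := by exact_mod_cast hm
  have hDm : D / m ≤ 1 := by
    obtain ⟨i, _⟩ := hA
    exact div_le_one_of_le₀ ((hD i).trans (by exact_mod_cast hd i)) hm'.le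
  have hr : 0 < D / m := by positivity
  by_cases hsmall : A.card * (D / m) ≤ L + 1
  · refine ⟨A, hA, hsmall, ?_⟩
    have h0 : 0 ≤ (G.card : ℝ) * coverProb m d A :=
      mul_nonneg hγ.le (coverProb_nonneg hd A)
    rcases hdev with h | h
    · left; nlinarith
    · right; nlinarith
  · have big : ∀ B : Finset I, L ≤ B.card * (D / m) → 1 - ε / 2 ≤ coverProb m d B := by
      intro B hB
      have h1 := one_sub_exp_le_coverProb hd hD B
      have h2 : Real.exp (-(B.card * (D / m))) ≤ Real.exp (-L) :=
        Real.exp_le_exp.mpr (neg_le_neg hB)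
      linarith
    have hpA : 1 - ε / 2 ≤ coverProb m d A := big A (by linarith)
    have hpA1 := coverProb_le_one hd A
    -- Downward, a subset of about `L m / D` classes covers no more than `A` does; upward, the mean is
    -- too close to `|G|`.
    rcases hdev with h | h
    · have hceil : ⌈L / (D / m)⌉₊ ≤ A.card := by
        refine Nat.ceil_le.mpr ?_
        rw [div_le_iff₀ hr]
        linarith
      obtain ⟨B, hBA, hB⟩ := Finset.exists_subset_card_eq hceil
      have hLB : L ≤ B.card * (D / m) := by
        rw [hB, ← div_le_iff₀ hr]
        exact Nat.le_ceil _
      have hpB := big B hLB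
      refine ⟨B, ?_, ?_, Or.inl ?_⟩
      · rw [← Finset.card_pos, hB]
        exact Nat.ceil_pos.mpr (by positivity)
      · have := (Nat.ceil_lt_add_one (a := L / (D / m)) (by positivity)).le
        rw [hB]
        calc (⌈L / (D / m)⌉₊ : ℝ) * (D / m) ≤ (L / (D / m) + 1) * (D / m) := by gcongr
          _ = L + D / m := by field_simp
          _ ≤ L + 1 := by linarith
      · have hmono : ((G ∩ B.biUnion T).card : ℝ) ≤ (G ∩ A.biUnion T).card := by
          exact_mod_cast Finset.card_le_card
            (Finset.inter_subset_inter_left (Finset.biUnion_subset_biUnion_of_subset_left T hBA))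
        calc ((G ∩ B.biUnion T).card : ℝ) ≤ (1 - ε) * (G.card * coverProb m d A) := hmono.trans h
          _ ≤ (1 - ε) * (G.card * 1) := by gcongr
          _ ≤ (1 - ε / 2) * (1 - ε / 2) * G.card := by nlinarith [mul_nonneg hγ.le (sq_nonneg ε)]
          _ ≤ (1 - ε / 2) * coverProb m d B * G.card := by gcongr; linarith
          _ = _ := by ring
    · exfalso
      have hle : ((G ∩ A.biUnion T).card : ℝ) ≤ G.card := by
        exact_mod_cast Finset.card_le_card Finset.inter_subset_left
      have h1 : (1 + ε) * (G.card * (1 - ε / 2)) ≤ G.card := by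
        refine le_trans ?_ (h.trans hle)
        gcongr
      nlinarith [mul_pos hγ (mul_pos hε0 (sub_pos.mpr hε1))]

/-- Union bound for one group of servers; by `exists_small_deviates` it runs only over the `B` with
`|B| D / m ≤ L + 1`, whose mean cover is at least `κ |B| D`. -/
lemma IsUniformAssignment.measure_exists_deviates_le [Fintype I] [IsProbabilityMeasure P]
    (hS : IsUniformAssignment P S d) (hm : 0 < m) (hd : ∀ i, d i ≤ m)
    {D L ε κ : ℝ} (hD : ∀ i, D ≤ d i) (hD0 : 0 < D) (hL : 0 < L) (hε0 : 0 < ε) (hε1 : ε < 1)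
    (hLε : Real.exp (-L) ≤ ε / 2) {G : Finset (Fin m)} (hκ0 : 0 < κ)
    (hκ : κ * (m * (L + 2)) ≤ G.card) :
    P.real {ω | ∃ A : Finset I, A.Nonempty ∧
        Deviates (A.biUnion fun i => S i ω) G ε (coverProb m d A)}
      ≤ 4 * (Fintype.card I * Real.exp (-(ε ^ 2 / 16 * κ * D))) := by
  classical
  have hm' : (0 : ℝ) < m := by exact_mod_cast hm
  have hγ : (0 : ℝ) < G.card := lt_of_lt_of_le (by positivity) hκ
  have hG : G.Nonempty := Finset.card_pos.mp (by exact_mod_cast hγ)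
  set q := Real.exp (-(ε ^ 2 / 16 * κ * D)) with hq
  -- If `1 ≤ |I| q`, the right-hand side is at least one.
  rcases le_total (Fintype.card I * q) 1 with hNq | hNq
  swap
  · exact measureReal_le_one.trans (by linarith)
  set F : Finset (Finset I) := {B | B.Nonempty ∧ B.card * (D / m) ≤ L + 1}
  have hbound : ∀ B ∈ F, P.real {ω | Deviates (B.biUnion fun i => S i ω) G (ε / 2)
      (coverProb m d B)} ≤ 2 * q ^ B.card := by
    intro B hB
    obtain ⟨-, hBL⟩ : B.Nonempty ∧ B.card * (D / m) ≤ L + 1 := by simpa [F] using hB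
    refine ((hS.binomiallyDominated hm hd B).measure_deviates (hS.aemeasurable_biUnion B)
      (coverProb_nonneg hd B) (coverProb_le_one hd B) G (δ := ε / 2) (by linarith)
      (by linarith)).trans ?_
    rw [hq, ← Real.exp_nat_mul]
    gcongr 2 * Real.exp ?_
    have hp : B.card * (D / m) / (L + 2) ≤ coverProb m d B := by
      have := div_le_one_sub_exp_neg (y := B.card * (D / m)) (by positivity) hBL
      rw [add_assoc, one_add_one_eq_two] at this
      exact this.trans (one_sub_exp_le_coverProb hd hD B)
    have hmean : κ * B.card * D ≤ G.card * coverProb m d B := by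
      calc κ * B.card * D = κ * (m * (L + 2)) * (B.card * (D / m) / (L + 2)) := by
            field_simp
        _ ≤ G.card * coverProb m d B := by gcongr
    nlinarith [mul_le_mul_of_nonneg_left hmean (sq_nonneg ε)]
  calc P.real {ω | ∃ A : Finset I, A.Nonempty ∧
        Deviates (A.biUnion fun i => S i ω) G ε (coverProb m d A)}
      ≤ P.real (⋃ B ∈ F, {ω | Deviates (B.biUnion fun i => S i ω) G (ε / 2)
          (coverProb m d B)}) := by
        refine measureReal_mono ?_ (measure_ne_top _ _)
        rintro ω ⟨A, hA, hdev⟩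
        obtain ⟨B, hB, hBL, hBdev⟩ :=
          exists_small_deviates hd hD hD0 hm hL hε0 hε1 hLε hG (fun i => S i ω) hA hdev
        simp only [Set.mem_iUnion]
        exact ⟨B, by simp [F, hB, hBL], hBdev⟩
    _ ≤ ∑ B ∈ F, P.real {ω | Deviates (B.biUnion fun i => S i ω) G (ε / 2)
          (coverProb m d B)} := measureReal_biUnion_finset_le _ _
    _ ≤ ∑ B ∈ F, 2 * q ^ B.card := Finset.sum_le_sum hbound
    _ ≤ ∑ B : Finset I with B.Nonempty, 2 * q ^ B.card := by
        refine Finset.sum_le_sum_of_subset_of_nonneg ?_ fun _ _ _ => by positivity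
        intro B hB
        simp only [F, Finset.mem_filter] at hB ⊢
        exact ⟨hB.1, hB.2.1⟩
    _ ≤ 4 * (Fintype.card I * q) := by
        rw [← Finset.mul_sum, sum_nonempty_pow_card]
        linarith [one_add_pow_sub_one_le (Real.exp_pos _).le (Fintype.card I) hNq]

/-! ### From groups of servers to ranks -/

lemma rankFun_eq_sum_groups {J : ℕ} {cap : Fin m → ℝ} {grp : Fin m → Fin J} {c : Fin J → ℝ}
    (hc : ∀ s, cap s = c (grp s)) (T : I → Finset (Fin m)) (A : Finset I) :
    rankFun cap T A = ∑ j, c j *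
      ((Finset.univ.filter fun s => grp s = j) ∩ A.biUnion T).card := by
  rw [rankFun, ← Finset.sum_fiberwise (A.biUnion T) grp]
  refine Finset.sum_congr rfl fun j _ => ?_
  rw [Finset.sum_congr rfl fun s hs => (hc s).trans (congrArg c (Finset.mem_filter.mp hs).2),
    Finset.sum_const, nsmul_eq_mul, mul_comm]
  congr 3
  ext s
  simp [and_comm]

lemma IsUniformAssignment.meanRank_eq [IsProbabilityMeasure P]
    (hS : IsUniformAssignment P S d) (hm : 0 < m) (hd : ∀ i, d i ≤ m)
    {J : ℕ} {cap : Fin m → ℝ} {grp : Fin m → Fin J} {c : Fin J → ℝ}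
    (hc : ∀ s, cap s = c (grp s)) (A : Finset I) :
    meanRank P cap S A = ∑ j, c j *
      ((Finset.univ.filter fun s => grp s = j).card * coverProb m d A) := by
  have hX := hS.aemeasurable_biUnion A
  simp only [meanRank, rankFun_eq_sum_groups hc]
  rw [integral_finsetSum _ fun j _ => (integrable_comp_finset (P := P) hX fun T =>
    (((Finset.univ.filter fun s => grp s = j) ∩ T).card : ℝ)).const_mul _]
  refine Finset.sum_congr rfl fun j _ => ?_
  rw [integral_const_mul, (hS.binomiallyDominated hm hd A).integral_card hX]

/-- Some group must have positive capacity: otherwise rank and mean rank vanish, and both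
inequalities hold trivially. -/
lemma IsUniformAssignment.exists_group_deviates [IsProbabilityMeasure P]
    (hS : IsUniformAssignment P S d) (hm : 0 < m) (hd : ∀ i, d i ≤ m)
    {J : ℕ} {cap : Fin m → ℝ} {grp : Fin m → Fin J} {c : Fin J → ℝ}
    (hc : ∀ s, cap s = c (grp s)) (hc0 : ∀ j, 0 ≤ c j) (hpos : ∃ j, 0 < c j) {ε : ℝ}
    (A : Finset I) (ω : Ω)
    (h : rankFun cap (fun i => S i ω) A ≤ (1 - ε) * meanRank P cap S A ∨
      (1 + ε) * meanRank P cap S A ≤ rankFun cap (fun i => S i ω) A) :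
    ∃ j, Deviates (A.biUnion fun i => S i ω) (Finset.univ.filter fun s => grp s = j) ε
      (coverProb m d A) := by
  obtain ⟨j₀, hj₀⟩ := hpos
  by_contra! hno
  simp only [Deviates, not_or, not_le] at hno
  rw [hS.meanRank_eq hm hd hc, rankFun_eq_sum_groups hc, Finset.mul_sum, Finset.mul_sum] at h
  rcases h with h | h
  · refine h.not_gt (Finset.sum_lt_sum (fun j _ => ?_) ⟨j₀, Finset.mem_univ _, ?_⟩)
    · rw [mul_left_comm]
      exact mul_le_mul_of_nonneg_left (hno j).1.le (hc0 j)
    · rw [mul_left_comm]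
      exact mul_lt_mul_of_pos_left (hno j₀).1 hj₀
  · refine h.not_gt (Finset.sum_lt_sum (fun j _ => ?_) ⟨j₀, Finset.mem_univ _, ?_⟩)
    · rw [mul_left_comm (1 + ε)]
      exact mul_le_mul_of_nonneg_left (hno j).2.le (hc0 j)
    · rw [mul_left_comm (1 + ε)]
      exact mul_lt_mul_of_pos_left (hno j₀).2 hj₀

lemma IsUniformAssignment.measure_exists_rank_deviation_le [Fintype I] [IsProbabilityMeasure P]
    (hS : IsUniformAssignment P S d) (hm : 0 < m) (hd : ∀ i, d i ≤ m)
    {D L ε κ : ℝ} (hD : ∀ i, D ≤ d i) (hD0 : 0 < D) (hL : 0 < L) (hε0 : 0 < ε) (hε1 : ε < 1)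
    (hLε : Real.exp (-L) ≤ ε / 2) (hκ0 : 0 < κ)
    {J : ℕ} {cap : Fin m → ℝ} {grp : Fin m → Fin J}
    (hcap : ∀ s, 0 ≤ cap s) (hpos : ∃ s, 0 < cap s)
    (hgrp : ∀ s t, grp s = grp t → cap s = cap t)
    (hκ : ∀ j, κ * (m * (L + 2)) ≤ (Finset.univ.filter fun s => grp s = j).card) :
    P.real {ω | ∃ A : Finset I, A.Nonempty ∧
        (rankFun cap (fun i => S i ω) A ≤ (1 - ε) * meanRank P cap S A ∨
          (1 + ε) * meanRank P cap S A ≤ rankFun cap (fun i => S i ω) A)}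
      ≤ J * (4 * (Fintype.card I * Real.exp (-(ε ^ 2 / 16 * κ * D)))) := by
  have hm' : (0 : ℝ) < m := by exact_mod_cast hm
  have hrep : ∀ j, ∃ s, grp s = j := by
    intro j
    have h : (0 : ℝ) < (Finset.univ.filter fun s => grp s = j).card :=
      lt_of_lt_of_le (by positivity) (hκ j)
    obtain ⟨s, hs⟩ := Finset.card_pos.mp (by exact_mod_cast h :
      0 < (Finset.univ.filter fun s => grp s = j).card)
    exact ⟨s, (Finset.mem_filter.mp hs).2⟩
  choose r hr using hrep
  have hc : ∀ s, cap s = cap (r (grp s)) := fun s => hgrp _ _ (hr _).symm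
  calc _ ≤ P.real (⋃ j : Fin J, {ω | ∃ A : Finset I, A.Nonempty ∧
        Deviates (A.biUnion fun i => S i ω) (Finset.univ.filter fun s => grp s = j) ε
          (coverProb m d A)}) := by
        refine measureReal_mono ?_
        rintro ω ⟨A, hA, h⟩
        obtain ⟨j, hj⟩ := hS.exists_group_deviates hm hd (c := fun j => cap (r j)) hc
          (fun j => hcap _) (by obtain ⟨s, hs⟩ := hpos; exact ⟨grp s, by rwa [← hc]⟩) A ω h
        exact Set.mem_iUnion.mpr ⟨j, A, hA, hj⟩
    _ ≤ ∑ j : Fin J, P.real {ω | ∃ A : Finset I, A.Nonempty ∧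
        Deviates (A.biUnion fun i => S i ω) (Finset.univ.filter fun s => grp s = j) ε
          (coverProb m d A)} := measureReal_iUnion_fintype_le _
    _ ≤ ∑ _j : Fin J, 4 * (Fintype.card I * Real.exp (-(ε ^ 2 / 16 * κ * D))) :=
        Finset.sum_le_sum fun j _ =>
          hS.measure_exists_deviates_le hm hd hD hD0 hL hε0 hε1 hLε hκ0 (hκ j)
    _ = _ := by simp

end

/-! ### Asymptotics -/

lemma isOmegaLog_inf' {K : ℕ} (h : (Finset.univ : Finset (Fin K)).Nonempty) {d : ℕ → Fin K → ℝ}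
    (hd : ∀ k, IsOmegaLog fun n => d n k) :
    IsOmegaLog fun n => Finset.univ.inf' h (d n) := by
  refine tendsto_atTop.mpr fun M => ?_
  filter_upwards [eventually_all.mpr fun k => tendsto_atTop.mp (hd k) M] with n hn
  obtain ⟨k, -, hk⟩ := Finset.exists_mem_eq_inf' h (d n)
  simpa only [hk] using hn k

lemma IsOmegaLog.const_mul_sub_log {f : ℕ → ℝ} (hf : IsOmegaLog f) {c a : ℝ} (hc : 0 < c)
    (ha : 0 < a) : IsOmegaLog fun n => c * f n - Real.log (a * n) := by
  have hlog : Tendsto (fun n : ℕ => Real.log n) atTop atTop :=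
    Real.tendsto_log_atTop.comp tendsto_natCast_atTop_atTop
  have h1 : Tendsto (fun n : ℕ => c * (f n / Real.log n) + (-(Real.log a / Real.log n) - 1))
      atTop atTop :=
    (hf.const_mul_atTop hc).atTop_add
      (((tendsto_const_nhds.div_atTop hlog).neg).sub_const 1)
  refine h1.congr' ?_
  filter_upwards [hlog.eventually_gt_atTop 0, eventually_gt_atTop 0] with n hn hn0
  rw [Real.log_mul ha.ne' (by positivity)]
  field_simp
  ring

theorem theorem5 (K : ℕ) (hK : 1 ≤ K) (b : ℝ) (hb : 0 < b)
    -- the partition of the `K * n` classes into `K` parts of size `n`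
    (part : ∀ n : ℕ, Fin (K * n) → Fin K)
    (hpart : ∀ n, 1 ≤ n → ∀ k, (Finset.univ.filter fun i => part n i = k).card = n)
    -- the capacities of the `⌈b n⌉` servers
    (cap : ∀ n : ℕ, Fin ⌈b * (n : ℝ)⌉₊ → ℝ)
    (hcap_nonneg : ∀ n, 1 ≤ n → ∀ s, 0 ≤ cap n s)
    (hcap_pos : ∀ n, 1 ≤ n → ∃ s, 0 < cap n s)
    (hservers : HasLinearServerGroups cap)
    -- the degrees of parallelism
    (d : ∀ _n : ℕ, Fin K → ℕ)
    (hd_pos : ∀ n, 1 ≤ n → ∀ k, 1 ≤ d n k)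
    (hd_le : ∀ n, 1 ≤ n → ∀ k, d n k ≤ ⌈b * (n : ℝ)⌉₊)
    (hdegrees : ∀ k, IsOmegaLog fun n => (d n k : ℝ))
    -- the random assignments
    {Ω : ℕ → Type*} [∀ n, MeasurableSpace (Ω n)]
    (P : ∀ n, Measure (Ω n)) [∀ n, IsProbabilityMeasure (P n)]
    (S : ∀ n : ℕ, Fin (K * n) → Ω n → Finset (Fin ⌈b * (n : ℝ)⌉₊))
    (hS : ∀ n, 1 ≤ n → IsUniformAssignment (P n) (S n) fun i => d n (part n i))
    (ε : ℝ) (hε0 : 0 < ε) (hε1 : ε < 1) :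
    ∃ g : ℕ → ℝ, IsOmegaLog g ∧ ∀ n, 1 ≤ n →
      (P n).real {ω | ∃ A : Finset (Fin (K * n)), A.Nonempty ∧
          rankFun (cap n) (fun i => S n i ω) A ≤ (1 - ε) * meanRank (P n) (cap n) (S n) A}
        ≤ Real.exp (-g n) ∧
      (P n).real {ω | ∃ A : Finset (Fin (K * n)), A.Nonempty ∧
          (1 + ε) * meanRank (P n) (cap n) (S n) A ≤ rankFun (cap n) (fun i => S n i ω) A}
        ≤ Real.exp (-g n) := by
  obtain ⟨J, grp, hgrp, hsize⟩ := hservers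
  have hJ : Nonempty (Fin J) := (hcap_pos 1 le_rfl).elim fun s _ => ⟨grp 1 s⟩
  have hJ0 : 0 < J := Fin.pos_iff_nonempty.mpr hJ
  have hKne : (Finset.univ : Finset (Fin K)).Nonempty := ⟨⟨0, hK⟩, Finset.mem_univ _⟩
  choose c₀ hc₀ hc₀size using hsize
  -- The least of the linear rates of the groups serves for all of them.
  obtain ⟨j₀, hj₀⟩ := Finite.exists_min c₀
  set c := c₀ j₀
  have hc : 0 < c := hc₀ j₀
  set L := Real.log (2 / ε) with hLdef
  have hL : 0 < L := Real.log_pos (by rw [lt_div_iff₀ hε0]; linarith)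
  have hLε : Real.exp (-L) ≤ ε / 2 := by
    rw [hLdef, Real.exp_neg, Real.exp_log (by positivity), inv_div]
  set κ := c / ((b + 1) * (L + 2)) with hκdef
  have hκ0 : 0 < κ := by positivity
  set D : ℕ → ℝ := fun n => Finset.univ.inf' hKne fun k => (d n k : ℝ)
  have hD : IsOmegaLog D := isOmegaLog_inf' hKne hdegrees
  set a : ℝ := 4 * J * K
  have ha : 0 < a := by positivity
  set good : ℕ → Prop := fun n =>
    ∀ j, c * n ≤ ((Finset.univ.filter fun s => grp n s = j).card : ℝ)
  have hgood : ∀ᶠ n in atTop, good n := eventually_all.mpr fun j => by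
    filter_upwards [hc₀size j] with n hn
    exact (mul_le_mul_of_nonneg_right (hj₀ j) (Nat.cast_nonneg n)).trans hn
  classical
  -- While some group is still too small, `g n = 0` gives the trivial bound one.
  refine ⟨fun n => if good n then ε ^ 2 / 16 * κ * D n - Real.log (a * n) else 0, ?_, ?_⟩
  · refine Tendsto.congr' ?_ (hD.const_mul_sub_log (c := ε ^ 2 / 16 * κ) (by positivity) ha)
    filter_upwards [hgood] with n hn
    rw [if_pos hn]
  intro n hn
  by_cases hng : good n
  swap
  · simp only [if_neg hng, neg_zero, Real.exp_zero]
    exact ⟨measureReal_le_one, measureReal_le_one⟩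
  have hn' : (0 : ℝ) < n := by exact_mod_cast hn
  have hm : 0 < ⌈b * (n : ℝ)⌉₊ := Nat.ceil_pos.mpr (by positivity)
  have hmle : (⌈b * (n : ℝ)⌉₊ : ℝ) ≤ (b + 1) * n := by
    have h1 : (1 : ℝ) ≤ n := by exact_mod_cast hn
    linarith [Nat.ceil_lt_add_one (a := b * (n : ℝ)) (by positivity)]
  have hDn : ∀ i, D n ≤ d n (part n i) := fun i =>
    Finset.inf'_le (fun k => (d n k : ℝ)) (Finset.mem_univ _)
  have hDn0 : 0 < D n := (Finset.lt_inf'_iff _).mpr fun k _ => by exact_mod_cast hd_pos n hn k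
  have hκ : ∀ j, κ * (⌈b * (n : ℝ)⌉₊ * (L + 2))
      ≤ (Finset.univ.filter fun s => grp n s = j).card := by
    intro j
    refine le_trans ?_ (hng j)
    calc κ * (⌈b * (n : ℝ)⌉₊ * (L + 2)) ≤ κ * ((b + 1) * n * (L + 2)) := by gcongr
      _ = c * n := by rw [hκdef]; field_simp
  have key := (hS n hn).measure_exists_rank_deviation_le hm (fun i => hd_le n hn _) hDn hDn0 hL
    hε0 hε1 hLε hκ0 (hcap_nonneg n hn) (hcap_pos n hn) (hgrp n hn) hκ
  have hexp : (J : ℝ) * (4 * (Fintype.card (Fin (K * n)) * Real.exp (-(ε ^ 2 / 16 * κ * D n))))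
      = Real.exp (-(ε ^ 2 / 16 * κ * D n - Real.log (a * n))) := by
    rw [neg_sub, sub_eq_add_neg, Real.exp_add, Real.exp_log (by positivity), Fintype.card_fin]
    push_cast
    ring
  rw [hexp] at key
  simp only [if_pos hng]
  constructor
  · refine le_trans (measureReal_mono ?_ (measure_ne_top _ _)) key
    rintro ω ⟨A, hA, h⟩
    exact ⟨A, hA, Or.inl h⟩
  · refine le_trans (measureReal_mono ?_ (measure_ne_top _ _)) key
    rintro ω ⟨A, hA, h⟩
    exact ⟨A, hA, Or.inr h⟩
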